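/- Let $(k_n)_{n\ge 0}$ be a sequence of positive real numbers, and let $\mathcal R_k$ be the Hilbert space of power series $f(z)=\sum_{n\ge 0} f_n z^n$ with complex coefficients and finite norm $\|f\|=\big(\sum_{n\ge 0}|f_n|^2/k_n\big)^{1/2}$. Assume that $\mathcal R_k$ is a Banach algebra with respect to the multiplication of power series (that is, $fg\in\mathcal R_k$ and $\|fg\|\le C\|f\|\,\|g\|$ for all $f,g\in\mathcal R_k$, with a constant $C$ independent of $f$ and $g$), and that $$\lim_{n\to\infty}\Big(\inf_{j\ge 0}\frac{k_j}{k_{n+j}}\Big)^{1/n}=\lim_{n\to\infty}k_n^{1/n}=1 .$$ Let $d$ be a non-negative integer, let $\mathcal R_k^d$ be the direct sum of $d$ copies of $\mathcal R_k$, and let $M_z f=zf$ be the (bounded) operator of multiplication by $z$ on $\mathcal R_k^d$. Let $\mathbb D$ be the open unit disc. For a closed subspace $\mathcal J\subset\mathcal R_k^d$ with $M_z\mathcal J\subset\mathcal J$, define the spectrum of $\mathcal J$ by $$\sigma(\mathcal J)=\big\{\lambda\in\overline{\mathbb D}:\ \{g(\lambda):g\in\mathcal J\}\ne\mathbb C^d\big\},$$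 and let $\sigma(\mathcal M_z)$ be the spectrum of the bounded operator $\mathcal M_z[f]=[zf]$ on the quotient space $\mathcal R_k^d/\mathcal J$. Then, for every closed $M_z$-invariant subspace $\mathcal J$ of $\mathcal R_k^d$, $$\sigma(\mathcal J)\cap\mathbb D=\sigma(\mathcal M_z)\cap\mathbb D .$$ -/

import Mathlib

open Filter Topology

noncomputable section

/-- A sequence `k 0, k 1, k 2, …` of (strictly) positive real numbers. -/
structure WeightSeq where
  /-- the `n`-th term -/
  coeff : ℕ → ℝ
  pos : ∀ n, 0 < coeff n

instance : CoeFun WeightSeq (fun _ => ℕ → ℝ) := ⟨WeightSeq.coeff⟩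

/-- The space `R_k` of the power series `f = ∑ f_n z^n` with `∑ |f_n|² / k_n < ∞`. -/
def Rk (k : WeightSeq) : Submodule ℂ (PowerSeries ℂ) where
  carrier := {f | Summable fun n => ‖PowerSeries.coeff n f‖ ^ 2 / k n}
  zero_mem' := by simp [summable_zero]
  add_mem' := by
    intro f g hf hg
    refine Summable.of_nonneg_of_le (fun n => div_nonneg (sq_nonneg _) (k.pos n).le) (fun n => ?_)
      ((hf.add hg).mul_left 2)
    rw [← add_div, ← mul_div_assoc]
    refine div_le_div_of_nonneg_right ?_ (k.pos n).le
    have h := norm_add_le (PowerSeries.coeff n f) (PowerSeries.coeff n g)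
    rw [map_add]
    nlinarith [sq_nonneg (‖PowerSeries.coeff n f‖ - ‖PowerSeries.coeff n g‖),
      norm_nonneg (PowerSeries.coeff n f + PowerSeries.coeff n g)]
  smul_mem' := by
    intro c f hf
    refine (Summable.mul_left (‖c‖ ^ 2) hf).congr (fun n => ?_)
    simp [mul_pow, mul_div_assoc]

namespace Rk

variable {k : WeightSeq}

/-- The map `f ↦ (f_n / √k_n)_n` from `R_k` to `ℓ²`; the norm of `R_k` is the one that makes
it isometric. -/
def toL2 (k : WeightSeq) : Rk k →ₗ[ℂ] lp (fun _ : ℕ => ℂ) 2 where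
  toFun f := ⟨fun n => PowerSeries.coeff n f.1 / (Real.sqrt (k n) : ℂ), by
    refine memℓp_gen ?_
    refine Summable.congr f.2 (fun n => ?_)
    have h : ‖(Real.sqrt (k n) : ℂ)‖ ^ 2 = k n := by
      rw [Complex.norm_real, Real.norm_eq_abs, sq_abs, Real.sq_sqrt (k.pos n).le]
    simp [-Complex.norm_real, div_pow, h]⟩
  map_add' f g := by
    ext n
    exact (congrArg (· / (Real.sqrt (k n) : ℂ)) (map_add (PowerSeries.coeff n) f.1 g.1)).trans
      (add_div _ _ _)
  map_smul' c f := by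
    ext n
    simp [mul_div_assoc]

theorem toL2_injective (k : WeightSeq) : Function.Injective (toL2 k) := by
  intro f g h
  apply Subtype.ext
  ext n
  have h1 := congrArg (fun a : lp (fun _ : ℕ => ℂ) 2 => (a : ℕ → ℂ) n) h
  have h2 : (Real.sqrt (k n) : ℂ) ≠ 0 :=
    Complex.ofReal_ne_zero.2 (Real.sqrt_pos.2 (k.pos n)).ne'
  exact (div_left_inj' h2).1 h1

instance : NormedAddCommGroup (Rk k) :=
  NormedAddCommGroup.induced (Rk k) (lp (fun _ : ℕ => ℂ) 2) (toL2 k) (toL2_injective k)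

instance : NormedSpace ℂ (Rk k) :=
  NormedSpace.induced ℂ (Rk k) (lp (fun _ : ℕ => ℂ) 2) (toL2 k)

/-- The norm of `R_k` is `(∑ |f_n|² / k_n)^{1/2}`. -/
theorem norm_eq (f : Rk k) :
    ‖f‖ = Real.sqrt (∑' n, ‖PowerSeries.coeff n (f : PowerSeries ℂ)‖ ^ 2 / k n) := by
  have h0 : ‖f‖ = ‖toL2 k f‖ := rfl
  have h := lp.norm_rpow_eq_tsum (p := 2) (by norm_num) (toL2 k f)
  have h1 : ‖toL2 k f‖ ^ 2
      = ∑' n, ‖PowerSeries.coeff n (f : PowerSeries ℂ)‖ ^ 2 / k n := by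
    simp only [ENNReal.toReal_ofNat, Real.rpow_ofNat] at h
    rw [h]
    refine tsum_congr (fun n => ?_)
    have h2 : ‖(Real.sqrt (k n) : ℂ)‖ ^ 2 = k n := by
      rw [Complex.norm_real, Real.norm_eq_abs, sq_abs, Real.sq_sqrt (k.pos n).le]
    simp [toL2, -Complex.norm_real, div_pow, h2]
  rw [← h1, h0, Real.sqrt_sq (norm_nonneg _)]

/-- The value `f(lam) = ∑ f_n lam^n`. -/
def eval (lam : ℂ) (f : Rk k) : ℂ := ∑' n, PowerSeries.coeff n (f : PowerSeries ℂ) * lam ^ n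

/-- The power series `z` belongs to `R_k`. -/
theorem X_mem (k : WeightSeq) : (PowerSeries.X : PowerSeries ℂ) ∈ Rk k := by
  refine summable_of_ne_finset_zero (s := {1}) (fun n hn => ?_)
  have : n ≠ 1 := by simpa using hn
  simp [PowerSeries.coeff_X, this]

end Rk

/-- `R_k` is a Banach algebra with respect to the multiplication of power series (up to passing
to an equivalent norm): it is closed under this multiplication, which is bounded. -/
def IsBanachAlgebraRk (k : WeightSeq) : Prop :=
  ∃ C : ℝ, ∀ f g : Rk k, ∃ h : Rk k,
    (h : PowerSeries ℂ) = (f : PowerSeries ℂ) * (g : PowerSeries ℂ) ∧ ‖h‖ ≤ C * ‖f‖ * ‖g‖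

variable {k : WeightSeq}

theorem IsBanachAlgebraRk.X_mul_mem (hk : IsBanachAlgebraRk k) (f : Rk k) :
    PowerSeries.X * (f : PowerSeries ℂ) ∈ Rk k := by
  obtain ⟨C, hC⟩ := hk
  obtain ⟨h, hh, -⟩ := hC ⟨PowerSeries.X, Rk.X_mem k⟩ f
  have : (h : PowerSeries ℂ) = PowerSeries.X * (f : PowerSeries ℂ) := hh
  exact this ▸ h.2

/-- The bounded operator `M_z : f ↦ z f` on `R_k`. -/
def Mz (hk : IsBanachAlgebraRk k) : Rk k →L[ℂ] Rk k :=
  LinearMap.mkContinuousOfExistsBound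
    { toFun := fun f => ⟨PowerSeries.X * (f : PowerSeries ℂ), hk.X_mul_mem f⟩
      map_add' := fun f g => Subtype.ext (mul_add _ _ _)
      map_smul' := fun c f => Subtype.ext (mul_smul_comm _ _ _) }
    (by
      obtain ⟨C, hC⟩ := hk
      refine ⟨C * ‖(⟨PowerSeries.X, Rk.X_mem k⟩ : Rk k)‖, fun f => ?_⟩
      obtain ⟨h, hh, hn⟩ := hC ⟨PowerSeries.X, Rk.X_mem k⟩ f
      refine le_trans (le_of_eq ?_) hn
      exact congrArg norm (Subtype.ext hh.symm))

/-- The Hilbert direct sum `R_k^d` of `d` copies of `R_k`. -/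
abbrev RkPow (k : WeightSeq) (d : ℕ) : Type := PiLp 2 (fun _ : Fin d => Rk k)

/-- The operator `M_z : f ↦ z f` on `R_k^d`, acting in each component. -/
def MzPow (hk : IsBanachAlgebraRk k) (d : ℕ) : RkPow k d →L[ℂ] RkPow k d :=
  ((PiLp.continuousLinearEquiv 2 ℂ (fun _ : Fin d => Rk k)).symm :
      ((i : Fin d) → Rk k) →L[ℂ] RkPow k d) ∘L
    ContinuousLinearMap.piMap (fun _ : Fin d => Mz hk) ∘L
    (PiLp.continuousLinearEquiv 2 ℂ (fun _ : Fin d => Rk k) :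
      RkPow k d →L[ℂ] ((i : Fin d) → Rk k))

theorem MzPow_apply (hk : IsBanachAlgebraRk k) (d : ℕ) (f : RkPow k d) (i : Fin d) :
    ((MzPow hk d f i : Rk k) : PowerSeries ℂ) = PowerSeries.X * (f i : PowerSeries ℂ) := rfl

/-- The quotient operator `[f] ↦ [z f]` on `R_k^d / J`, for an `M_z`-invariant subspace `J`. -/
def quotMz (hk : IsBanachAlgebraRk k) {d : ℕ} (J : Submodule ℂ (RkPow k d))
    (hJ : ∀ f ∈ J, MzPow hk d f ∈ J) : (RkPow k d ⧸ J) →L[ℂ] (RkPow k d ⧸ J) :=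
  J.liftQL (J.mkQL ∘L MzPow hk d) (fun f hf => by
    simpa using hJ f hf)

theorem quotMz_mk (hk : IsBanachAlgebraRk k) {d : ℕ} (J : Submodule ℂ (RkPow k d))
    (hJ : ∀ f ∈ J, MzPow hk d f ∈ J) (f : RkPow k d) :
    quotMz hk J hJ (J.mkQ f) = J.mkQ (MzPow hk d f) := rfl

/-- The fiber `{ g(lam) : g ∈ J }` of `J` over `lam`. -/
def fiber {d : ℕ} (J : Submodule ℂ (RkPow k d)) (lam : ℂ) : Set (Fin d → ℂ) :=
  {v | ∃ g ∈ J, ∀ i, v i = Rk.eval lam (g i)}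

/-- The spectrum of `J`: the points of the closed unit disc over which the fiber of `J` is not
all of `ℂ^d`. -/
def fiberSpectrum {d : ℕ} (J : Submodule ℂ (RkPow k d)) : Set ℂ :=
  {lam | lam ∈ Metric.closedBall (0 : ℂ) 1 ∧ fiber J lam ≠ Set.univ}

end

/-! For `‖lam‖ < 1`, invertibility of `lam - quotMz` is equivalent to fullness of the fiber at
`lam`. If `lam - quotMz` is onto, solving for the class of a constant vector `v` gives an element of
`J` of the form `v - (lam - z) g`, whose value at `lam` is `v`. Conversely, let the fiber be full.
Surjectivity is division: some `j ∈ J` agrees with `f` at `lam`, so `j - f = (z - lam) g` with `g`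
in `R_k^d`. For injectivity, Cramer's rule gives `φ` with `φ(lam) = 1` and `φ R_k^d ⊆ J`
(`exists_mulL_mem_of_fiber_eq_univ`). Dividing, `φ - 1 = (z - lam) ψ`, so `f = φ f + ψ (lam - z) f`
lies in `J` once `(lam - z) f` does. The analytic input is division by `z - lam` inside `R_k`
(`exists_eq_sub_mul_of_eval_eq_zero`): the limit of the weight ratios bounds powers of the backward
shift (`exists_weight_le`), so its resolvent series converges. -/

namespace Rk

/-! ### Completeness, coefficients and monomial expansions in `R_k`. -/

theorem mem_iff {k : WeightSeq} {f : PowerSeries ℂ} :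
    f ∈ Rk k ↔ Summable fun n => ‖PowerSeries.coeff n f‖ ^ 2 / k n := Iff.rfl

theorem norm_sq_eq {k : WeightSeq} (f : Rk k) :
    ‖f‖ ^ 2 = ∑' n, ‖PowerSeries.coeff n (f : PowerSeries ℂ)‖ ^ 2 / k n := by
  rw [norm_eq, Real.sq_sqrt (tsum_nonneg fun n => div_nonneg (sq_nonneg _) (k.pos n).le)]

theorem norm_coeff_le {k : WeightSeq} (f : Rk k) (n : ℕ) :
    ‖PowerSeries.coeff n (f : PowerSeries ℂ)‖ ≤ Real.sqrt (k n) * ‖f‖ := by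
  have h := (mem_iff.1 f.2).le_tsum n
    (fun m _ => div_nonneg (sq_nonneg ‖PowerSeries.coeff m (f : PowerSeries ℂ)‖) (k.pos m).le)
  rw [← norm_sq_eq, div_le_iff₀ (k.pos n)] at h
  refine le_of_sq_le_sq ?_ (by positivity)
  rw [mul_pow, Real.sq_sqrt (k.pos n).le]
  linarith

theorem toL2_isometry (k : WeightSeq) : Isometry (toL2 k) :=
  AddMonoidHomClass.isometry_of_norm _ fun _ => rfl

/-- Multiplying the `n`-th entry by `√(k n)` inverts the rescaling. This transfers completeness from
`ℓ²` to `R_k`. -/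
theorem toL2_surjective (k : WeightSeq) : Function.Surjective (toL2 k) := by
  intro a
  have h2 (n : ℕ) : (Real.sqrt (k n) : ℂ) ≠ 0 :=
    Complex.ofReal_ne_zero.2 (Real.sqrt_pos.2 (k.pos n)).ne'
  have ha : Summable fun n => ‖(a : ℕ → ℂ) n‖ ^ 2 := by
    simpa using (lp.memℓp a).summable (by norm_num)
  refine ⟨⟨PowerSeries.mk fun n => (a : ℕ → ℂ) n * Real.sqrt (k n), mem_iff.2 ?_⟩, ?_⟩
  · refine ha.congr fun n => ?_
    have h : ‖(Real.sqrt (k n) : ℂ)‖ ^ 2 = k n := by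
      rw [Complex.norm_real, Real.norm_eq_abs, sq_abs, Real.sq_sqrt (k.pos n).le]
    rw [PowerSeries.coeff_mk, norm_mul, mul_pow, h, mul_div_cancel_right₀ _ (k.pos n).ne']
  · ext n
    simp [toL2, h2 n]

instance (k : WeightSeq) : CompleteSpace (Rk k) :=
  ((toL2_isometry k).isUniformInducing.completeSpace_congr (toL2_surjective k)).2 inferInstance

/-- The `n`-th coefficient as a continuous linear functional on `R_k`. -/
noncomputable def coeffL (k : WeightSeq) (n : ℕ) : Rk k →L[ℂ] ℂ :=
  LinearMap.mkContinuous ((PowerSeries.coeff n).comp (Rk k).subtype) (Real.sqrt (k n))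
    fun f => norm_coeff_le f n

@[simp]
theorem coeffL_apply {k : WeightSeq} (n : ℕ) (f : Rk k) :
    coeffL k n f = PowerSeries.coeff n (f : PowerSeries ℂ) := rfl

theorem monomial_mem (k : WeightSeq) (n : ℕ) (c : ℂ) : PowerSeries.monomial n c ∈ Rk k := by
  refine summable_of_ne_finset_zero (s := {n}) (fun m hm => ?_)
  have : m ≠ n := by simpa using hm
  simp [PowerSeries.coeff_monomial, this]

/-- A power series in `R_k` is the sum of its terms, in the norm of `R_k`. -/
theorem hasSum_monomial {k : WeightSeq} (f : Rk k) :
    HasSum (fun n => (⟨PowerSeries.monomial n (PowerSeries.coeff n (f : PowerSeries ℂ)),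
      monomial_mem k n _⟩ : Rk k)) f := by
  rw [← (toL2_isometry k).isUniformInducing.isInducing.hasSum_iff]
  refine (lp.hasSum_single (by norm_num) (toL2 k f)).congr_fun ?_
  intro n
  ext m
  by_cases h : m = n
  · subst h
    simp [toL2]
  · simp [toL2, PowerSeries.coeff_monomial, h]

/-! ### Weight growth, the backward shift and division by `z - lam`. -/

/-- The weights `k (n + j)` are controlled by `k j`, up to a factor of arbitrarily small
exponential growth in `n`. -/
theorem exists_weight_le {k : WeightSeq} (hk : IsBanachAlgebraRk k)
    (hm : Tendsto (fun n : ℕ => (⨅ j : ℕ, k j / k (n + j)) ^ (1 / (n : ℝ))) atTop (𝓝 1))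
    {r : ℝ} (hr0 : 0 < r) (hr : r < 1) :
    ∃ D : ℝ, 0 < D ∧ ∀ n j, k (n + j) ≤ D ^ 2 * (r⁻¹ ^ n) ^ 2 * k j := by
  obtain ⟨c, hc, hstep⟩ : ∃ c : ℝ, 1 ≤ c ∧ ∀ j, k j ≤ c * k (j + 1) := by
    -- Apply boundedness of `M_z` to `z^j`, using `‖z^m‖² = 1 / k m`. The maximum with `1` makes
    -- powers of `c` at least `1`.
    refine ⟨max 1 (‖Mz hk‖ ^ 2), le_max_left _ _, fun j => ?_⟩
    have hmon (m : ℕ) : ‖(⟨PowerSeries.monomial m 1, monomial_mem k m 1⟩ : Rk k)‖ ^ 2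
        = (k m)⁻¹ := by
      rw [norm_sq_eq, tsum_eq_single m]
      · simp
      · intro n hn
        simp [PowerSeries.coeff_monomial, hn]
    have h := (Mz hk).le_opNorm ⟨PowerSeries.monomial j 1, monomial_mem k j 1⟩
    have he : Mz hk ⟨PowerSeries.monomial j 1, monomial_mem k j 1⟩
        = ⟨PowerSeries.monomial (j + 1) 1, monomial_mem k (j + 1) 1⟩ := by
      apply Subtype.ext
      change PowerSeries.X * PowerSeries.monomial j (1 : ℂ) = PowerSeries.monomial (j + 1) 1
      rw [← PowerSeries.X_pow_eq, ← PowerSeries.X_pow_eq, pow_succ']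
    rw [he] at h
    have h' := pow_le_pow_left₀ (norm_nonneg _) h 2
    rw [mul_pow, hmon, hmon, ← div_eq_mul_inv, le_div_iff₀ (k.pos j),
      inv_mul_le_iff₀ (k.pos _), mul_comm] at h'
    exact h'.trans (mul_le_mul_of_nonneg_right (le_max_right _ _) (k.pos _).le)
  have hiter : ∀ m j, k j ≤ c ^ m * k (m + j) := by
    intro m j
    induction m with
    | zero => simp
    | succ m ih =>
      calc k j ≤ c ^ m * k (m + j) := ih
        _ ≤ c ^ m * (c * k (m + j + 1)) := by gcongr; exact hstep _
        _ = c ^ (m + 1) * k (m + 1 + j) := by rw [add_right_comm]; ring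
  have hlarge : ∃ N, ∀ n, N ≤ n → ∀ j, k (n + j) ≤ (r⁻¹ ^ n) ^ 2 * k j := by
    have h1 : ∀ᶠ n : ℕ in atTop, r ^ 2 < (⨅ j : ℕ, k j / k (n + j)) ^ (1 / (n : ℝ)) :=
      hm.eventually_const_lt (by nlinarith)
    -- At `n = 0` the exponent `1 / n` is `0` in Lean, so the root can be undone only for `n > 0`.
    obtain ⟨N, hN⟩ := eventually_atTop.1 (h1.and (eventually_gt_atTop 0))
    refine ⟨N, fun n hn j => ?_⟩
    obtain ⟨h2, h3⟩ := hN n hn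
    have hpos (i : ℕ) : 0 ≤ k i / k (n + i) := (div_pos (k.pos _) (k.pos _)).le
    have h4 := pow_le_pow_left₀ (by positivity) h2.le n
    rw [one_div, Real.rpow_inv_natCast_pow (Real.iInf_nonneg hpos) h3.ne'] at h4
    have h5 : (r ^ 2) ^ n ≤ k j / k (n + j) :=
      h4.trans (ciInf_le ⟨0, by rintro _ ⟨i, rfl⟩; exact hpos i⟩ j)
    rw [le_div_iff₀ (k.pos _)] at h5
    calc k (n + j) = (r⁻¹ ^ n) ^ 2 * ((r ^ 2) ^ n * k (n + j)) := by
          rw [← mul_assoc, ← pow_mul, ← pow_mul, mul_comm n 2, ← mul_pow,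
            inv_mul_cancel₀ hr0.ne', one_pow, one_mul]
      _ ≤ _ := by gcongr
  obtain ⟨N, hN⟩ := hlarge
  have hr1 : 1 ≤ r⁻¹ := (one_le_inv₀ hr0).2 hr.le
  -- The limit controls only shifts of length at least `N`. Passing from `n + j` up to `N + n + j`
  -- costs `c ^ N` and leaves a shift by `N + n ≥ N`.
  refine ⟨c ^ N * r⁻¹ ^ N, by positivity, fun n j => ?_⟩
  have hc' : (c ^ N) ≤ (c ^ N) ^ 2 := le_self_pow₀ (one_le_pow₀ hc) two_ne_zero
  calc k (n + j) ≤ c ^ N * k (N + (n + j)) := hiter _ _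
    _ = c ^ N * k ((N + n) + j) := by rw [add_assoc]
    _ ≤ (c ^ N) ^ 2 * ((r⁻¹ ^ (N + n)) ^ 2 * k j) :=
        mul_le_mul hc' (hN _ (Nat.le_add_right _ _) _) (k.pos _).le (by positivity)
    _ = _ := by rw [pow_add]; ring

theorem summable_norm_eval {k : WeightSeq} (hk : IsBanachAlgebraRk k)
    (hm : Tendsto (fun n : ℕ => (⨅ j : ℕ, k j / k (n + j)) ^ (1 / (n : ℝ))) atTop (𝓝 1))
    {lam : ℂ} (hlam : ‖lam‖ < 1) (f : Rk k) :
    Summable fun n => ‖PowerSeries.coeff n (f : PowerSeries ℂ) * lam ^ n‖ := by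
  obtain ⟨r, hr, hr1⟩ := exists_between hlam
  have hr0 : 0 < r := (norm_nonneg _).trans_lt hr
  obtain ⟨D, hD, hb⟩ := exists_weight_le hk hm hr0 hr1
  have hg : Summable fun n : ℕ => (‖lam‖ / r) ^ n :=
    summable_geometric_of_lt_one (by positivity) ((div_lt_one hr0).2 hr)
  refine Summable.of_nonneg_of_le (fun n => norm_nonneg _) (fun n => ?_)
    (hg.mul_left (D * Real.sqrt (k 0) * ‖f‖))
  have h1 : Real.sqrt (k n) ≤ D * r⁻¹ ^ n * Real.sqrt (k 0) := by
    refine (Real.sqrt_le_sqrt (hb n 0)).trans_eq ?_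
    rw [← mul_pow, Real.sqrt_mul (by positivity), Real.sqrt_sq (by positivity)]
  calc _ = ‖PowerSeries.coeff n (f : PowerSeries ℂ)‖ * ‖lam‖ ^ n := by rw [norm_mul, norm_pow]
    _ ≤ (D * r⁻¹ ^ n * Real.sqrt (k 0) * ‖f‖) * ‖lam‖ ^ n := by
        gcongr
        exact (norm_coeff_le f n).trans (by gcongr)
    _ = _ := by rw [div_pow, inv_pow]; ring

/-- The backward shift `f ↦ ∑ f_{n+j} z^j` maps `R_k` into itself, with norm bounded by the growth
of the weights. -/
theorem exists_coeff_eq_coeff_add {k : WeightSeq} {n : ℕ} {c : ℝ} (hc : 0 ≤ c)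
    (hb : ∀ j, k (n + j) ≤ c ^ 2 * k j) (f : Rk k) :
    ∃ g : Rk k, (∀ j, PowerSeries.coeff j (g : PowerSeries ℂ)
      = PowerSeries.coeff (n + j) (f : PowerSeries ℂ)) ∧ ‖g‖ ≤ c * ‖f‖ := by
  have hs : Summable fun j =>
      ‖PowerSeries.coeff (n + j) (f : PowerSeries ℂ)‖ ^ 2 / k (n + j) :=
    (mem_iff.1 f.2).comp_injective (add_right_injective n)
  have hle (j : ℕ) : ‖PowerSeries.coeff (n + j) (f : PowerSeries ℂ)‖ ^ 2 / k j
      ≤ c ^ 2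
        * (‖PowerSeries.coeff (n + j) (f : PowerSeries ℂ)‖ ^ 2 / k (n + j)) := by
    have hj := k.pos j
    have hnj := k.pos (n + j)
    rw [← mul_div_assoc, div_le_div_iff₀ hj hnj]
    have := mul_le_mul_of_nonneg_left (hb j)
      (sq_nonneg ‖PowerSeries.coeff (n + j) (f : PowerSeries ℂ)‖)
    linarith
  have hs' : Summable fun j => ‖PowerSeries.coeff (n + j) (f : PowerSeries ℂ)‖ ^ 2 / k j :=
    Summable.of_nonneg_of_le (fun j => div_nonneg (sq_nonneg _) (k.pos j).le) hle
      (hs.mul_left _)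
  refine ⟨⟨PowerSeries.mk fun j => PowerSeries.coeff (n + j) (f : PowerSeries ℂ),
    mem_iff.2 (by simpa only [PowerSeries.coeff_mk] using hs')⟩,
    fun j => by simp only [PowerSeries.coeff_mk], ?_⟩
  refine le_of_sq_le_sq ?_ (by positivity)
  rw [mul_pow, norm_sq_eq, norm_sq_eq]
  simp only [PowerSeries.coeff_mk]
  calc _ ≤ ∑' j, c ^ 2
        * (‖PowerSeries.coeff (n + j) (f : PowerSeries ℂ)‖ ^ 2 / k (n + j)) :=
        hs'.tsum_le_tsum hle (hs.mul_left _)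
    _ = c ^ 2
        * ∑' j, ‖PowerSeries.coeff (n + j) (f : PowerSeries ℂ)‖ ^ 2 / k (n + j) :=
        tsum_mul_left
    _ ≤ _ := by
        refine mul_le_mul_of_nonneg_left ?_ (sq_nonneg c)
        exact tsum_comp_le_tsum_of_inj (mem_iff.1 f.2)
          (fun j => div_nonneg (sq_nonneg _) (k.pos j).le) (add_right_injective n)

/-- A power series in `R_k` that vanishes at a point `lam` of the open unit disc is divisible by
`z - lam` in `R_k`. -/
theorem exists_eq_sub_mul_of_eval_eq_zero {k : WeightSeq} (hk : IsBanachAlgebraRk k)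
    (hm : Tendsto (fun n : ℕ => (⨅ j : ℕ, k j / k (n + j)) ^ (1 / (n : ℝ))) atTop (𝓝 1))
    {lam : ℂ} (hlam : ‖lam‖ < 1) (f : Rk k) (hf : eval lam f = 0) :
    ∃ g : Rk k, (f : PowerSeries ℂ)
      = (PowerSeries.X - PowerSeries.C lam) * (g : PowerSeries ℂ) := by
  obtain ⟨r, hr, hr1⟩ := exists_between hlam
  have hr0 : 0 < r := (norm_nonneg _).trans_lt hr
  obtain ⟨D, hD, hb⟩ := exists_weight_le hk hm hr0 hr1
  have hshift (n : ℕ) := exists_coeff_eq_coeff_add (n := n) (c := D * r⁻¹ ^ n) (by positivity)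
    (fun j => by rw [mul_pow]; exact hb n j) f
  choose L hL hLn using hshift
  have hsum : Summable fun n => lam ^ n • L (n + 1) := by
    have hg : Summable fun n : ℕ => (‖lam‖ / r) ^ n :=
      summable_geometric_of_lt_one (by positivity) ((div_lt_one hr0).2 hr)
    refine Summable.of_norm_bounded (hg.mul_left (D * r⁻¹ * ‖f‖)) fun n => ?_
    rw [norm_smul, norm_pow]
    calc _ ≤ ‖lam‖ ^ n * (D * r⁻¹ ^ (n + 1) * ‖f‖) := by gcongr; exact hLn _
      _ = _ := by rw [div_eq_mul_inv, mul_pow, pow_succ]; ring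
  -- With `B` the backward shift, the quotient is `∑ lam^n B^(n+1) f`; its `j`-th coefficient is `∑
  -- f_(n+1+j) lam^n`.
  refine ⟨∑' n, lam ^ n • L (n + 1), ?_⟩
  have hcoeff (j : ℕ) : HasSum
      (fun n => PowerSeries.coeff (n + 1 + j) (f : PowerSeries ℂ) * lam ^ n)
      (PowerSeries.coeff j ((∑' n, lam ^ n • L (n + 1) : Rk k) : PowerSeries ℂ)) := by
    have := (coeffL k j).hasSum hsum.hasSum
    simpa [hL, mul_comm] using this
  have heval : HasSum (fun n => PowerSeries.coeff n (f : PowerSeries ℂ) * lam ^ n) 0 := by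
    rw [← hf]
    exact (summable_norm_eval hk hm hlam f).of_norm.hasSum
  generalize (∑' n, lam ^ n • L (n + 1) : Rk k) = g at hcoeff
  ext j
  rw [sub_mul, map_sub, PowerSeries.coeff_C_mul]
  -- The constant term, `f_0 = -lam g_0`, is where `f(lam) = 0` enters. The others, `f_(j+1) = g_j -
  -- lam g_(j+1)`, come from splitting off the first term of the series for `g_j`.
  cases j with
  | zero =>
    rw [PowerSeries.coeff_zero_X_mul]
    have h1 := (hasSum_nat_add_iff' 1).2 heval
    have h2 := (hcoeff 0).mul_left lam
    have h3 := h1.unique (h2.congr_fun fun n => by simp only [add_zero]; ring)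
    simp at h3
    simp only [zero_sub, ← h3, neg_neg, PowerSeries.coeff_zero_eq_constantCoeff]
  | succ j =>
    rw [PowerSeries.coeff_succ_X_mul]
    have h1 := (hasSum_nat_add_iff' 1).2 (hcoeff j)
    have h2 := (hcoeff (j + 1)).mul_left lam
    have h3 := h1.unique (h2.congr_fun fun n => by
      rw [show n + 1 + 1 + j = n + 1 + (j + 1) by ring]; ring)
    rw [← h3]
    simp [add_comm]

end Rk

/-! ### `R_k` as an algebra, with point evaluations as characters. -/

namespace Rk

theorem one_mem (k : WeightSeq) : (1 : PowerSeries ℂ) ∈ Rk k := by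
  simpa using monomial_mem k 0 1

theorem mul_mem {k : WeightSeq} (hk : IsBanachAlgebraRk k) {f g : PowerSeries ℂ}
    (hf : f ∈ Rk k) (hg : g ∈ Rk k) : f * g ∈ Rk k := by
  obtain ⟨C, hC⟩ := hk
  obtain ⟨h, hh, -⟩ := hC ⟨f, hf⟩ ⟨g, hg⟩
  have : (h : PowerSeries ℂ) = f * g := hh
  exact this ▸ h.2

/-- The space `R_k` as a subalgebra of the algebra of power series. -/
noncomputable def toSubalgebra {k : WeightSeq} (hk : IsBanachAlgebraRk k) : Subalgebra ℂ (PowerSeries ℂ) :=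
  (Rk k).toSubalgebra (one_mem k) fun _ _ => mul_mem hk

theorem eval_one {k : WeightSeq} (lam : ℂ) : eval lam ⟨1, one_mem k⟩ = 1 := by
  rw [eval, tsum_eq_single 0]
  · simp
  · intro n hn
    simp [PowerSeries.coeff_one, hn]

theorem eval_C {k : WeightSeq} (lam c : ℂ) (h : PowerSeries.C c ∈ Rk k) :
    eval lam ⟨PowerSeries.C c, h⟩ = c := by
  rw [eval, tsum_eq_single 0]
  · simp
  · intro n hn
    simp [PowerSeries.coeff_C, hn]

theorem eval_X {k : WeightSeq} (lam : ℂ) : eval lam ⟨PowerSeries.X, X_mem k⟩ = lam := by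
  rw [eval, tsum_eq_single 1]
  · simp
  · intro n hn
    simp [PowerSeries.coeff_X, hn]

/-- Absolute convergence inside the disc permits the Cauchy product. -/
theorem eval_mul {k : WeightSeq} (hk : IsBanachAlgebraRk k)
    (hm : Tendsto (fun n : ℕ => (⨅ j : ℕ, k j / k (n + j)) ^ (1 / (n : ℝ))) atTop (𝓝 1))
    {lam : ℂ} (hlam : ‖lam‖ < 1) (f g : Rk k) :
    eval lam ⟨f.1 * g.1, mul_mem hk f.2 g.2⟩ = eval lam f * eval lam g := by
  unfold eval
  rw [tsum_mul_tsum_eq_tsum_sum_antidiagonal_of_summable_norm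
    (summable_norm_eval hk hm hlam f) (summable_norm_eval hk hm hlam g)]
  refine tsum_congr fun n => ?_
  rw [PowerSeries.coeff_mul, Finset.sum_mul]
  refine Finset.sum_congr rfl fun p hp => ?_
  rw [← Finset.HasAntidiagonal.mem_antidiagonal.1 hp, pow_add]
  ring

/-- Evaluation at a point of the open unit disc, as a linear functional on `R_k`. -/
noncomputable def evalₗ {k : WeightSeq} (hk : IsBanachAlgebraRk k)
    (hm : Tendsto (fun n : ℕ => (⨅ j : ℕ, k j / k (n + j)) ^ (1 / (n : ℝ))) atTop (𝓝 1))
    {lam : ℂ} (hlam : ‖lam‖ < 1) : Rk k →ₗ[ℂ] ℂ where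
  toFun := eval lam
  map_add' f g := by
    have hf := (summable_norm_eval hk hm hlam f).of_norm
    have hg := (summable_norm_eval hk hm hlam g).of_norm
    simp only [eval, ← hf.tsum_add hg, Submodule.coe_add, map_add, add_mul]
  map_smul' c f := by
    simp only [eval, ← tsum_mul_left, Submodule.coe_smul, map_smul, smul_eq_mul, mul_assoc,
      RingHom.id_apply]

/-- Evaluation at a point of the open unit disc, as a ring homomorphism on `R_k`. -/
noncomputable def evalHom {k : WeightSeq} (hk : IsBanachAlgebraRk k)
    (hm : Tendsto (fun n : ℕ => (⨅ j : ℕ, k j / k (n + j)) ^ (1 / (n : ℝ))) atTop (𝓝 1))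
    {lam : ℂ} (hlam : ‖lam‖ < 1) : toSubalgebra hk →+* ℂ where
  toFun f := eval lam ⟨f.1, f.2⟩
  map_one' := eval_one lam
  map_zero' := (evalₗ hk hm hlam).map_zero
  map_add' f g := (evalₗ hk hm hlam).map_add ⟨f.1, f.2⟩ ⟨g.1, g.2⟩
  map_mul' f g := eval_mul hk hm hlam ⟨f.1, f.2⟩ ⟨g.1, g.2⟩

/-- For `f` in `R_k`, the bounded operator `a ↦ a f` on `R_k`. -/
noncomputable def mulL {k : WeightSeq} (hk : IsBanachAlgebraRk k) (f : Rk k) : Rk k →L[ℂ] Rk k :=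
  LinearMap.mkContinuousOfExistsBound
    { toFun := fun a => ⟨a.1 * f.1, mul_mem hk a.2 f.2⟩
      map_add' := fun a b => Subtype.ext (add_mul _ _ _)
      map_smul' := fun c a => Subtype.ext (smul_mul_assoc _ _ _) }
    (by
      obtain ⟨C, hC⟩ := hk
      refine ⟨C * ‖f‖, fun a => ?_⟩
      obtain ⟨h, hh, hn⟩ := hC a f
      refine le_trans (le_of_eq ?_) (hn.trans_eq (by ring))
      exact congrArg norm (Subtype.ext hh.symm))

end Rk

/-! ### Closed invariant subspaces as `R_k`-modules, and Cramer's rule. -/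

namespace RkPow

open Rk

/-- For `f` in `R_k^d`, the bounded operator `a ↦ a f` from `R_k` to `R_k^d`. -/
noncomputable def mulL {k : WeightSeq} (hk : IsBanachAlgebraRk k) {d : ℕ} (f : RkPow k d) :
    Rk k →L[ℂ] RkPow k d :=
  ((PiLp.continuousLinearEquiv 2 ℂ (fun _ : Fin d => Rk k)).symm :
      ((i : Fin d) → Rk k) →L[ℂ] RkPow k d) ∘L
    ContinuousLinearMap.pi fun i => Rk.mulL hk (f i)

theorem mulL_apply {k : WeightSeq} (hk : IsBanachAlgebraRk k) {d : ℕ} (f : RkPow k d)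
    (a : Rk k) (i : Fin d) :
    ((mulL hk f a i : Rk k) : PowerSeries ℂ) = (a : PowerSeries ℂ) * (f i : PowerSeries ℂ) := rfl

/-- A closed `M_z`-invariant subspace of `R_k^d` is an `R_k`-submodule. -/
theorem mulL_mem {k : WeightSeq} (hk : IsBanachAlgebraRk k) {d : ℕ}
    {J : Submodule ℂ (RkPow k d)} (hJclosed : IsClosed (J : Set (RkPow k d)))
    (hJ : ∀ f ∈ J, MzPow hk d f ∈ J) {f : RkPow k d} (hf : f ∈ J) (a : Rk k) :
    mulL hk f a ∈ J := by
  -- Monomial multiples of `f` come from iterating `M_z`; a general `a` is the norm limit of its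
  -- partial sums, and `J` is closed.
  have hmon (n : ℕ) : mulL hk f ⟨PowerSeries.monomial n 1, monomial_mem k n 1⟩ ∈ J := by
    induction n with
    | zero =>
      convert hf using 1
      ext i : 1
      apply Subtype.ext
      simp [mulL_apply]
    | succ n ih =>
      convert hJ _ ih using 1
      ext i : 1
      apply Subtype.ext
      rw [mulL_apply, MzPow_apply, mulL_apply]
      simp only [← PowerSeries.X_pow_eq]
      ring
  have hmon' (n : ℕ) (c : ℂ) :
      mulL hk f ⟨PowerSeries.monomial n c, monomial_mem k n c⟩ ∈ J := by
    convert J.smul_mem c (hmon n) using 1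
    rw [← map_smul]
    congr 1
    apply Subtype.ext
    simp [← map_smul]
  exact hJclosed.mem_of_tendsto ((mulL hk f).hasSum (hasSum_monomial a))
    (Eventually.of_forall fun s => J.sum_mem fun n _ => hmon' n _)

/-- If the fiber of `J` over a point `lam` of the open unit disc is everything, then `J` contains
`φ R_k^d` for some `φ` in `R_k` with `φ(lam) = 1`. -/
theorem exists_mulL_mem_of_fiber_eq_univ {k : WeightSeq} (hk : IsBanachAlgebraRk k)
    (hm : Tendsto (fun n : ℕ => (⨅ j : ℕ, k j / k (n + j)) ^ (1 / (n : ℝ))) atTop (𝓝 1))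
    {d : ℕ} {J : Submodule ℂ (RkPow k d)} (hJclosed : IsClosed (J : Set (RkPow k d)))
    (hJ : ∀ f ∈ J, MzPow hk d f ∈ J) {lam : ℂ} (hlam : ‖lam‖ < 1)
    (hfib : fiber J lam = Set.univ) :
    ∃ φ : Rk k, eval lam φ = 1 ∧ ∀ f : RkPow k d, mulL hk f φ ∈ J := by
  have h (c : Fin d) : (fun i => if i = c then (1 : ℂ) else 0) ∈ fiber J lam :=
    hfib ▸ Set.mem_univ _
  choose g hgJ hg using h
  -- The columns of `G` lie in `J` and `G(lam)` is the identity; `φ` is `det G`.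
  let G : Matrix (Fin d) (Fin d) (toSubalgebra hk) := fun i c => ⟨(g c i).1, (g c i).2⟩
  refine ⟨⟨G.det.1, G.det.2⟩, ?_, fun f => ?_⟩
  · change evalHom hk hm hlam G.det = 1
    rw [RingHom.map_det]
    convert Matrix.det_one (n := Fin d) (R := ℂ)
    ext i c
    exact (hg c i).symm.trans (Matrix.one_apply (i := i) (j := c)).symm
  · let F : Fin d → toSubalgebra hk := fun i => ⟨(f i).1, (f i).2⟩
    -- Since `G · adj(G) = det G`, the vector `det G • F` is a combination of the columns of `G`
    -- with coefficients `v` in `R_k`.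
    let v := G.adjugate.mulVec F
    have hv : G.mulVec v = G.det • F := by
      rw [Matrix.mulVec_mulVec, Matrix.mul_adjugate, Matrix.smul_mulVec, Matrix.one_mulVec]
    have hsum : mulL hk f ⟨G.det.1, G.det.2⟩
        = ∑ c, mulL hk (g c) ⟨(v c).1, (v c).2⟩ := by
      ext i : 1
      apply Subtype.ext
      have h1 := congrArg (toSubalgebra hk).subtype (congrFun hv i)
      rw [mulL_apply, WithLp.ofLp_sum, Finset.sum_apply, Submodule.coe_sum]
      simp only [mulL_apply]
      refine h1.symm.trans ?_
      simp only [Matrix.mulVec, dotProduct, map_sum, map_mul]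
      exact Finset.sum_congr rfl fun c _ => mul_comm _ _
    rw [hsum]
    exact J.sum_mem fun c _ => mulL_mem hk hJclosed hJ (hgJ c) _

end RkPow

/-! ### Invertibility on the quotient and fullness of the fiber. -/

theorem isUnit_sub_quotMz_iff {k : WeightSeq} (hk : IsBanachAlgebraRk k)
    (hm : Tendsto (fun n : ℕ => (⨅ j : ℕ, k j / k (n + j)) ^ (1 / (n : ℝ))) atTop (𝓝 1))
    {d : ℕ} {J : Submodule ℂ (RkPow k d)} (hJclosed : IsClosed (J : Set (RkPow k d)))
    (hJ : ∀ f ∈ J, MzPow hk d f ∈ J) {lam : ℂ} (hlam : ‖lam‖ < 1) :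
    IsUnit (algebraMap ℂ _ lam - quotMz hk J hJ) ↔ fiber J lam = Set.univ := by
  have hcl : IsClosed (J : Set (RkPow k d)) := hJclosed
  -- As `J` is closed, the quotient is a Banach space and the open mapping theorem applies.
  rw [ContinuousLinearMap.isUnit_iff_bijective]
  have hT (f : RkPow k d) : (algebraMap ℂ (RkPow k d ⧸ J →L[ℂ] RkPow k d ⧸ J) lam
      - quotMz hk J hJ) (J.mkQ f) = J.mkQ (lam • f - MzPow hk d f) := by
    rw [map_sub, map_smul]
    rfl
  constructor
  · rintro ⟨-, hsurj⟩
    refine Set.eq_univ_of_forall fun v => ?_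
    have hC (c : ℂ) : PowerSeries.C c ∈ Rk k := by
      rw [← PowerSeries.monomial_zero_eq_C_apply]
      exact Rk.monomial_mem k 0 c
    let F : RkPow k d := WithLp.toLp 2 fun i => ⟨PowerSeries.C (v i), hC _⟩
    obtain ⟨q, hq⟩ := hsurj (J.mkQ F)
    obtain ⟨g, rfl⟩ := J.mkQ_surjective q
    rw [hT, eq_comm, ← sub_eq_zero, ← map_sub] at hq
    refine ⟨_, (Submodule.Quotient.mk_eq_zero J).1 hq, fun i => ?_⟩
    have h1 := Rk.eval_mul hk hm hlam ⟨PowerSeries.X, Rk.X_mem k⟩ (g i)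
    rw [Rk.eval_X] at h1
    have h2 : (Rk.evalₗ hk hm hlam) (F i - (lam • g i - MzPow hk d g i)) = v i := by
      rw [map_sub, map_sub, map_smul]
      change Rk.eval lam (F i) - (lam * Rk.eval lam (g i) - Rk.eval lam (MzPow hk d g i)) = _
      rw [show Rk.eval lam (MzPow hk d g i) = lam * Rk.eval lam (g i) from h1,
        show Rk.eval lam (F i) = v i from Rk.eval_C lam (v i) (hC _)]
      ring
    exact h2.symm
  · intro hfib
    refine ⟨?_, fun q => ?_⟩
    · rw [injective_iff_map_eq_zero]
      intro q hq
      obtain ⟨f, rfl⟩ := J.mkQ_surjective q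
      rw [hT] at hq
      have hfJ := (Submodule.Quotient.mk_eq_zero J).1 hq
      obtain ⟨φ, hφ, hφJ⟩ :=
        RkPow.exists_mulL_mem_of_fiber_eq_univ hk hm hJclosed hJ hlam hfib
      obtain ⟨ψ, hψ⟩ := Rk.exists_eq_sub_mul_of_eval_eq_zero hk hm hlam
        (φ - ⟨1, Rk.one_mem k⟩) (by
          change (Rk.evalₗ hk hm hlam) _ = 0
          rw [map_sub]
          change Rk.eval lam φ - Rk.eval lam _ = 0
          rw [hφ, Rk.eval_one, sub_self])
      refine (Submodule.Quotient.mk_eq_zero J).2 ?_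
      -- Here `f = φ f + ψ (lam - z) f`, because `φ - 1 = (z - lam) ψ`.
      convert J.add_mem (hφJ f) (RkPow.mulL_mem hk hJclosed hJ hfJ ψ) using 1
      ext i : 1
      apply Subtype.ext
      have h1 : (φ : PowerSeries ℂ) - 1 = (PowerSeries.X - PowerSeries.C lam) * ψ.1 := hψ
      change (f i : PowerSeries ℂ) = φ.1 * (f i).1
        + ψ.1 * (lam • (f i).1 - PowerSeries.X * (f i).1)
      rw [PowerSeries.smul_eq_C_mul]
      linear_combination (-(f i).1) * h1
    · obtain ⟨f, rfl⟩ := J.mkQ_surjective q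
      obtain ⟨j, hj, hjf⟩ : (fun i => Rk.eval lam (f i)) ∈ fiber J lam :=
        hfib ▸ Set.mem_univ _
      have h (i : Fin d) := Rk.exists_eq_sub_mul_of_eval_eq_zero hk hm hlam
        (j i - f i) (by
          change (Rk.evalₗ hk hm hlam) _ = 0
          rw [map_sub]
          exact sub_eq_zero.2 (hjf i).symm)
      choose g hg using h
      refine ⟨J.mkQ (WithLp.toLp 2 g), ?_⟩
      rw [hT, ← sub_eq_zero, ← map_sub]
      refine (Submodule.Quotient.mk_eq_zero J).2 ?_
      -- From `j - f = (z - lam) g` it follows that `(lam - z) g - f = -j`.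
      convert J.neg_mem hj using 1
      ext i : 1
      apply Subtype.ext
      have h1 : (j i).1 - (f i).1 = (PowerSeries.X - PowerSeries.C lam) * (g i).1 := hg i
      change lam • (g i).1 - PowerSeries.X * (g i).1 - (f i).1 = -(j i).1
      rw [PowerSeries.smul_eq_C_mul]
      linear_combination h1

theorem theorem5p3 (k : WeightSeq) (hk : IsBanachAlgebraRk k)
    (hm : Tendsto (fun n : ℕ => (⨅ j : ℕ, k j / k (n + j)) ^ (1 / (n : ℝ))) atTop (𝓝 1))
    (hk1 : Tendsto (fun n : ℕ => (k n) ^ (1 / (n : ℝ))) atTop (𝓝 1))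
    (d : ℕ) (J : Submodule ℂ (RkPow k d)) (hJclosed : IsClosed (J : Set (RkPow k d)))
    (hJ : ∀ f ∈ J, MzPow hk d f ∈ J) :
    fiberSpectrum J ∩ Metric.ball (0 : ℂ) 1
      = spectrum ℂ (quotMz hk J hJ) ∩ Metric.ball (0 : ℂ) 1 := by
  ext lam
  refine and_congr_left fun hlam => ?_
  rw [spectrum.mem_iff, isUnit_sub_quotMz_iff hk hm hJclosed hJ (mem_ball_zero_iff.1 hlam)]
  exact and_iff_right (Metric.ball_subset_closedBall hlam)
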